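/- Theorem 3.3. Assume Martin's Axiom $\mathsf{MA}$: for every nonempty ccc partially ordered set $P$ and every family $\mathcal D$ of fewer than $\mathfrak c$ dense subsets of $P$ there is a filter in $P$ meeting every member of $\mathcal D$. Then there is a compact Hausdorff space $K$ such that (a) $K$ is not separable; (b) $K$ supports a measure: there is a finite Borel measure $\mu$ on $K$, inner regular with respect to compact sets, with $\mu(U)>0$ for every nonempty open $U\subseteq K$; (c) there is a continuous map $f\colon K\to 2^\omega$ such that each fiber $f^{-1}[t]$, $t\in 2^\omega$, is homeomorphic to an ordinal number (with its order topology); (d) there is no continuous surjection from $K$ onto $[0,1]^{\omega_1}$; (e) $K$ has countable $\pi$-character, i.e. $\pi\chi(K)=\sup\{\pi(x,K)\colon x\in K\}\le\omega$, where $\pi(x,K)$ is the smallest cardinality of a $\pi$-base at $x$, that is, of a family $\mathcal P$ of nonempty open subsets of $K$ such that every open $V\ni x$ contains some $U\in\mathcal P$. -/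

import Mathlib

open Cardinal Ordinal MeasureTheory TopologicalSpace

/-- Two elements `p`, `q` of a forcing notion are compatible if they have a common lower bound
(a common extension). -/
def ForcingCompatible {P : Type*} [Preorder P] (p q : P) : Prop :=
  ∃ r : P, r ≤ p ∧ r ≤ q

/-- A forcing notion is ccc if each family of pairwise incompatible elements is countable. -/
def ForcingCCC (P : Type*) [Preorder P] : Prop :=
  ∀ A : Set P, A.Pairwise (fun p q => ¬ ForcingCompatible p q) → A.Countable

/-- A subset `D` of a forcing notion is dense if every element has an extension in `D`. -/
def ForcingDense {P : Type*} [Preorder P] (D : Set P) : Prop :=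
  ∀ p : P, ∃ d ∈ D, d ≤ p

/-- Martin's Axiom: for each nonempty ccc forcing notion `P` and each family of fewer than
continuum many dense subsets of `P` there is a filter in `P` that meets all of them.
(`Order.PFilter P` is the type of nonempty, upward closed, downward directed subsets of `P`.) -/
def MartinsAxiom : Prop :=
  ∀ (P : Type) [Preorder P] [Nonempty P], ForcingCCC P →
    ∀ 𝒟 : Set (Set P), #𝒟 < 𝔠 → (∀ D ∈ 𝒟, ForcingDense D) →
      ∃ G : Order.PFilter P, ∀ D ∈ 𝒟, ∃ p ∈ D, p ∈ G

/-- A family `ℬ` of nonempty open sets is a `π`-base at `x` if every open neighbourhood of `x`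
contains a member of `ℬ`. -/
def IsPiBaseAt {K : Type*} [TopologicalSpace K] (ℬ : Set (Set K)) (x : K) : Prop :=
  (∀ U ∈ ℬ, IsOpen U ∧ U.Nonempty) ∧ ∀ V : Set K, IsOpen V → x ∈ V → ∃ U ∈ ℬ, U ⊆ V

/-- `π(x, K)`: the smallest cardinality of a `π`-base at `x`. -/
noncomputable def piCharacterAt {K : Type*} [TopologicalSpace K] (x : K) : Cardinal :=
  sInf {κ : Cardinal | ∃ ℬ : Set (Set K), IsPiBaseAt ℬ x ∧ #ℬ = κ}

/-- `πχ(K)`: the supremum of the cardinals `π(x, K)` over all points `x` of `K`. -/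
noncomputable def piCharacter (K : Type*) [TopologicalSpace K] : Cardinal :=
  ⨆ x : K, piCharacterAt x

/-- A topological space supports a measure if there is a finite Borel measure on it that is Radon
(inner regular with respect to compact sets) and positive on each nonempty open set. -/
def SupportsRadonMeasure (K : Type*) [TopologicalSpace K] : Prop :=
  ∃ μ : @Measure K (borel K), @IsFiniteMeasure K (borel K) μ ∧
    @Measure.InnerRegular K (borel K) _ μ ∧ ∀ U : Set K, IsOpen U → U.Nonempty → 0 < μ U

/-- A topological space is homeomorphic to an ordinal number, that is, to the set of all ordinals
below some ordinal with the order topology. -/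
def IsHomeomorphicToOrdinal (X : Type) [TopologicalSpace X] : Prop :=
  ∃ o : Ordinal.{0}, Nonempty (X ≃ₜ Set.Iio o)

open Filter Topology
open scoped ENNReal

/-! Slaloms of finite weight form an ideal modulo finitely many blocks, and each is avoided by some
path in almost all blocks. Martin's Axiom makes this ideal `𝔠`-directed
(`Slalom.exists_upper_bound`), so a recursion of length `𝔠` yields a strictly increasing chain `A i`
that catches every path. The space is the closure of the tagged paths: to the compact metrizable
space of paths it adjoins clopen sets recording "`A i` is avoided from block `n` on".

Over a fixed path a point is determined by its rank, the first `i` with no true tag, so the fibres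
are ordinals. For a countable set, the slaloms at its ranks have one bound `B`; a path avoiding `B`
is caught by some `A i`, so no rank in the set exceeds `i`, and a nonempty clopen set given by a tag
of `i` is missed. Avoiding a slalom of finite weight from a late block on has positive probability,
which gives the measure. For the `π`-character, one well-chosen value in a late block, together with
one tag at the rank of `x`, decides any finite set of tags as at `x`.

A surjection onto `[0,1]^{ω_1}` would, by a fusion argument, leave a single fibre whose image in a
countable power of the interval contains `2^ω`; but compact ordinals have countable continuous
images in metrizable spaces. -/

/-- Points of the base space: one of `2 ^ n` values in the `n`-th block. -/
abbrev BlockSeq : Type := (n : ℕ) → Fin (2 ^ n)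

/-- A set of allowed values in each block. -/
abbrev Slalom : Type := (n : ℕ) → Finset (Fin (2 ^ n))

/-! ### Weights of slaloms -/

namespace Slalom

/-- The sum of the uniform probabilities of the blocks of a slalom. -/
noncomputable def weight (A : Slalom) : ℝ≥0∞ := ∑' n, ((A n).card : ℝ≥0∞) * 2⁻¹ ^ n

/-- The part of a slalom in the blocks from `n` on. -/
def tail (A : Slalom) (n : ℕ) : Slalom := fun m => if n ≤ m then A m else ∅

/-- The part of a slalom in the blocks before `n`. -/
def head (A : Slalom) (n : ℕ) : Slalom := fun m => if n ≤ m then ∅ else A m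

/-- The slalom whose only path is `s`. -/
def single (s : BlockSeq) : Slalom := fun n => {s n}

theorem weight_mono {A B : Slalom} (h : A ≤ B) : A.weight ≤ B.weight :=
  ENNReal.tsum_le_tsum fun n => by gcongr; exact h n

theorem weight_sup_le (A B : Slalom) : (A ⊔ B).weight ≤ A.weight + B.weight := by
  unfold weight
  rw [← ENNReal.tsum_add]
  refine ENNReal.tsum_le_tsum fun n => ?_
  rw [← add_mul]
  gcongr
  exact_mod_cast Finset.card_union_le (A n) (B n)

theorem weight_single_lt_top (s : BlockSeq) : (single s).weight < ∞ := by
  simp [weight, single, ENNReal.tsum_geometric]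

theorem head_sup_tail (A : Slalom) (n : ℕ) : A.head n ⊔ A.tail n = A := by
  funext m
  by_cases h : n ≤ m <;> simp [head, tail, h]

theorem head_le (A : Slalom) (n : ℕ) : A.head n ≤ A := by
  intro m
  by_cases h : n ≤ m <;> simp [head, h]

theorem weight_tail (A : Slalom) (n : ℕ) :
    (A.tail n).weight = ∑' k, ((A (k + n)).card : ℝ≥0∞) * 2⁻¹ ^ (k + n) := by
  unfold weight
  rw [← ENNReal.summable.sum_add_tsum_nat_add' (f := fun m =>
    (((A.tail n) m).card : ℝ≥0∞) * 2⁻¹ ^ m) (k := n), Finset.sum_eq_zero, zero_add]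
  · simp [tail]
  · intro m hm
    have : ¬ n ≤ m := by simpa using hm
    simp [tail, this]

theorem tendsto_weight_tail {A : Slalom} (hA : A.weight < ∞) :
    Tendsto (fun n => (A.tail n).weight) atTop (𝓝 0) := by
  simp_rw [weight_tail]
  exact ENNReal.tendsto_sum_nat_add _ hA.ne

/-- A full block contributes exactly 1 to the weight, and the terms of a convergent series tend to
0. -/
theorem eventually_exists_notMem {A : Slalom} (hA : A.weight < ∞) :
    ∀ᶠ m in atTop, ∃ z, z ∉ A m := by
  have h := ENNReal.tendsto_atTop_zero_of_tsum_ne_top hA.ne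
  filter_upwards [h.eventually_lt_const zero_lt_one] with m hm
  by_contra! hz
  have : A m = Finset.univ := Finset.eq_univ_iff_forall.2 hz
  rw [this, Finset.card_univ, Fintype.card_fin, Nat.cast_pow, ← mul_pow, Nat.cast_ofNat,
    ENNReal.mul_inv_cancel (by simp) (by simp), one_pow] at hm
  exact lt_irrefl _ hm

/-- A path that avoids a slalom of finite weight in almost all blocks. -/
theorem exists_eventually_notMem {A : Slalom} (hA : A.weight < ∞) :
    ∃ s : BlockSeq, ∀ᶠ m in atTop, s m ∉ A m := by
  classical
  refine ⟨fun m => if h : ∃ z, z ∉ A m then h.choose else 0, ?_⟩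
  filter_upwards [eventually_exists_notMem hA] with m hm
  rw [dif_pos hm]
  exact hm.choose_spec

/-! ### Forcing with light slaloms and the chain obtained from Martin's Axiom -/

/-- Slaloms of weight less than one; a stronger condition is a larger slalom. -/
abbrev Light : Type := {A : Slalom // A.weight < 1}ᵒᵈ

theorem exists_head_tail_lt (A : {A : Slalom // A.weight < 1}) :
    ∃ n, (A.1.head n).weight + ((A.1.tail n).weight + (A.1.tail n).weight) < 1 := by
  have h := tendsto_weight_tail (A.2.trans ENNReal.one_lt_top)
  have h2 : Tendsto (fun n => A.1.weight + ((A.1.tail n).weight + (A.1.tail n).weight)) atTop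
      (𝓝 (A.1.weight + (0 + 0))) := tendsto_const_nhds.add (h.add h)
  rw [add_zero, add_zero] at h2
  obtain ⟨n, hn⟩ := (h2.eventually_lt_const A.2).exists
  exact ⟨n, lt_of_le_of_lt (by gcongr; exact weight_mono (head_le _ _)) hn⟩

/-- Each condition is cut where its tail is so light that the head plus twice the tail still weighs
less than 1. Two conditions with the same cut and the same head are then compatible, and there are
only countably many such pairs. -/
theorem forcingCCC_light : ForcingCCC Light := by
  classical
  intro S hS
  choose N hN using exists_head_tail_lt
  let key : Light → ℕ × Finset (Σ m : ℕ, Fin (2 ^ m)) := fun A =>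
    (N A.ofDual, (Finset.range (N A.ofDual)).sigma A.ofDual.1)
  have hinj : Set.InjOn key S := by
    intro A hA B hB hAB
    by_contra hne
    refine hS hA hB hne ?_
    obtain ⟨h1, h2⟩ := Prod.mk.inj hAB
    have hhead : A.ofDual.1.head (N A.ofDual) = B.ofDual.1.head (N A.ofDual) := by
      funext m
      by_cases hm : N A.ofDual ≤ m
      · simp [head, hm]
      · ext z
        have := Finset.ext_iff.1 h2 ⟨m, z⟩
        rw [← h1] at this
        simpa [head, hm, not_le.1 hm] using this
    have hA' := hN A.ofDual
    have hB' := hN B.ofDual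
    rw [← h1, ← hhead] at hB'
    set n := N A.ofDual
    have hw : (A.ofDual.1 ⊔ B.ofDual.1).weight < 1 := by
      have hle : A.ofDual.1 ⊔ B.ofDual.1 ≤
          A.ofDual.1.head n ⊔ (A.ofDual.1.tail n ⊔ B.ofDual.1.tail n) := by
        conv_lhs => rw [← head_sup_tail A.ofDual.1 n, ← head_sup_tail B.ofDual.1 n, ← hhead]
        exact sup_le (sup_le le_sup_left (le_sup_left.trans le_sup_right))
          (sup_le le_sup_left (le_sup_right.trans le_sup_right))
      refine (weight_mono hle).trans_lt (((weight_sup_le _ _).trans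
        (add_le_add_right (weight_sup_le _ _) _)).trans_lt ?_)
      rcases le_total (A.ofDual.1.tail n).weight (B.ofDual.1.tail n).weight with h | h
      · exact lt_of_le_of_lt (by gcongr) hB'
      · exact lt_of_le_of_lt (by gcongr) hA'
    exact ⟨OrderDual.toDual ⟨_, hw⟩, (le_sup_left : A.ofDual.1 ≤ A.ofDual.1 ⊔ B.ofDual.1),
      (le_sup_right : B.ofDual.1 ≤ A.ofDual.1 ⊔ B.ofDual.1)⟩
  exact Set.MapsTo.countable_of_injOn (Set.mapsTo_univ key S) hinj (Set.to_countable _)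

/-- Under Martin's Axiom the ideal of slaloms of finite weight is `𝔠`-directed modulo finite
sets of blocks. -/
theorem exists_upper_bound (hMA : MartinsAxiom) {ι : Type} (hι : #ι < 𝔠) (A : ι → Slalom)
    (hA : ∀ i, (A i).weight < ∞) :
    ∃ B : Slalom, B.weight < ∞ ∧ ∀ i, ∀ᶠ m in atTop, A i m ⊆ B m := by
  classical
  let D : ι → Set Light := fun i => {p | ∀ᶠ m in atTop, A i m ⊆ p.ofDual.1 m}
  have hD : ∀ 𝒟 ∈ Set.range D, ForcingDense 𝒟 := by
    rintro _ ⟨i, rfl⟩ p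
    have h2 : Tendsto (fun n => p.ofDual.1.weight + ((A i).tail n).weight) atTop
        (𝓝 (p.ofDual.1.weight + 0)) := tendsto_const_nhds.add (tendsto_weight_tail (hA i))
    rw [add_zero] at h2
    obtain ⟨n, hn⟩ := (h2.eventually_lt_const p.ofDual.2).exists
    refine ⟨OrderDual.toDual ⟨p.ofDual.1 ⊔ (A i).tail n, (weight_sup_le _ _).trans_lt hn⟩, ?_,
      (le_sup_left : p.ofDual.1 ≤ p.ofDual.1 ⊔ (A i).tail n)⟩
    filter_upwards [eventually_ge_atTop n] with m hm z hz
    simp [tail, hm, hz]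
  have : Nonempty Light := ⟨OrderDual.toDual ⟨fun _ => ∅, by simp [weight]⟩⟩
  obtain ⟨G, hG⟩ := hMA Light forcingCCC_light (Set.range D) (mk_range_le.trans_lt hι) hD
  let B : Slalom := fun m => Finset.univ.filter fun z => ∃ p ∈ G, z ∈ p.ofDual.1 m
  -- Directedness of the filter puts any finite part of `B` inside one condition, which bounds the
  -- partial sums of the weight of `B` by 1.
  have hfin : ∀ S : Finset (Σ m : ℕ, Fin (2 ^ m)), (∀ q ∈ S, q.2 ∈ B q.1) →
      ∃ p ∈ G, ∀ q ∈ S, q.2 ∈ p.ofDual.1 q.1 := by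
    intro S
    induction S using Finset.induction_on with
    | empty =>
      intro _
      obtain ⟨p, hp⟩ := G.nonempty
      exact ⟨p, hp, by simp⟩
    | insert q S _ ih =>
      intro h
      obtain ⟨p, hp, hpS⟩ := ih fun r hr => h r (Finset.mem_insert_of_mem hr)
      obtain ⟨p', hp', hq⟩ := (Finset.mem_filter.1 (h q (Finset.mem_insert_self _ _))).2
      obtain ⟨r, hr, hrp, hrp'⟩ := G.directed p hp p' hp'
      refine ⟨r, hr, fun x hx => ?_⟩
      rcases Finset.mem_insert.1 hx with rfl | hx
      · exact (show p'.ofDual.1 ≤ r.ofDual.1 from hrp') _ hq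
      · exact (show p.ofDual.1 ≤ r.ofDual.1 from hrp) _ (hpS x hx)
  refine ⟨B, lt_of_le_of_lt ?_ ENNReal.one_lt_top, fun i => ?_⟩
  · refine ENNReal.tsum_le_of_sum_range_le fun n => ?_
    obtain ⟨p, -, hp⟩ := hfin ((Finset.range n).sigma B) (by simp)
    refine le_trans ?_ p.ofDual.2.le
    refine le_trans ?_ (ENNReal.sum_le_tsum (Finset.range n))
    refine Finset.sum_le_sum fun m hm => ?_
    gcongr
    exact fun z hz => hp ⟨m, z⟩ (Finset.mem_sigma.2 ⟨hm, hz⟩)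
  · obtain ⟨p, hp, hpG⟩ := hG (D i) ⟨i, rfl⟩
    filter_upwards [hp] with m hm z hz
    exact Finset.mem_filter.2 ⟨Finset.mem_univ _, p, hpG, hm hz⟩

/-- Under Martin's Axiom there is a well-ordered, strictly increasing modulo finite
chain of slaloms of finite weight that catches every path. -/
theorem exists_chain (hMA : MartinsAxiom) :
    ∃ (ι : Type) (_ : LinearOrder ι) (_ : WellFoundedLT ι) (A : ι → Slalom),
      (∀ i, (A i).weight < ∞) ∧ (∀ s : BlockSeq, ∃ i, ∀ᶠ m in atTop, s m ∈ A i m) ∧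
      (∀ i, ∀ᶠ m in atTop, (A i m).Nonempty) ∧ ∀ i j, i < j → ∀ᶠ m in atTop, A i m ⊂ A j m := by
  classical
  have hcard : #BlockSeq ≤ 𝔠 := by
    have h : Function.Injective fun (s : BlockSeq) (n : ℕ) => (s n : ℕ) := fun s t h =>
      funext fun n => Fin.ext (congrFun h n)
    simpa using mk_le_of_injective h
  let ι : Type := (ord 𝔠).ToType
  have hsmall : ∀ i : ι, #{j // j < i} < 𝔠 := fun i => by
    have h : #(Set.Iio i) < 𝔠 := by simpa [ι] using mk_Iio_lt (α := (ord 𝔠).ToType) i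
    exact h
  have hι : #BlockSeq ≤ #ι := by simpa [ι] using hcard
  obtain ⟨g⟩ := hι
  let p : ι → BlockSeq := Function.invFun g
  have hp : Function.Surjective p := Function.invFun_surjective g.injective
  have step : ∀ (i : ι) (F : ∀ j, j < i → {A : Slalom // A.weight < ∞}),
      ∃ B : {A : Slalom // A.weight < ∞}, (∀ᶠ m in atTop, p i m ∈ B.1 m) ∧
        ∀ j (hj : j < i), ∀ᶠ m in atTop, (F j hj).1 m ⊂ B.1 m := by
    intro i F
    obtain ⟨B, hB, hFB⟩ := exists_upper_bound hMA (hsmall i) (fun j => (F j.1 j.2).1)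
      fun j => (F j.1 j.2).2
    obtain ⟨u, hu⟩ := exists_eventually_notMem hB
    -- Adding `p i` catches the path with index `i`; adding `u`, which eventually avoids `B`, makes
    -- the inclusions strict.
    refine ⟨⟨B ⊔ (single u ⊔ single (p i)), (weight_sup_le _ _).trans_lt (ENNReal.add_lt_top.2
      ⟨hB, (weight_sup_le _ _).trans_lt (ENNReal.add_lt_top.2
        ⟨weight_single_lt_top u, weight_single_lt_top (p i)⟩)⟩)⟩, ?_, fun j hj => ?_⟩
    · exact Eventually.of_forall fun m => by simp [single]
    · filter_upwards [hu, hFB ⟨j, hj⟩] with m hm hsub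
      refine (Finset.ssubset_iff_of_subset fun z hz => ?_).2 ⟨u m, ?_, fun h => hm (hsub h)⟩
      · simp [hsub hz]
      · simp [single]
  choose F hF1 hF2 using step
  let A : ι → {A : Slalom // A.weight < ∞} := wellFounded_lt.fix F
  have hA : ∀ i, A i = F i fun j _ => A j := fun i => wellFounded_lt.fix_eq F i
  have hmem : ∀ i, ∀ᶠ m in atTop, p i m ∈ (A i).1 m := fun i => by
    rw [hA i]
    exact hF1 i _
  refine ⟨ι, inferInstance, inferInstance, fun i => (A i).1, fun i => (A i).2, fun s => ?_,
    fun i => (hmem i).mono fun m hm => ⟨_, hm⟩, fun i j h => ?_⟩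
  · obtain ⟨i, rfl⟩ := hp s
    exact ⟨i, hmem i⟩
  · have := hF2 j (fun t _ => A t) i h
    rwa [← hA j] at this

end Slalom

/-! ### Recognizing ordinals -/

/-- A compact space is homeomorphic to an ordinal if it has an injective rank function into a
well-order for which all open rays are open. -/
theorem isHomeomorphicToOrdinal_of_rank {X ι : Type} [TopologicalSpace X] [CompactSpace X]
    [LinearOrder ι] [WellFoundedLT ι] (ρ : X → ι) (hρ : Function.Injective ρ)
    (hgt : ∀ x, IsOpen {y | ρ x < ρ y}) (hlt : ∀ x, IsOpen {y | ρ y < ρ x}) :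
    IsHomeomorphicToOrdinal X := by
  let r : X → X → Prop := fun x y => ρ x < ρ y
  have : IsWellOrder X r := (RelEmbedding.preimage ⟨ρ, hρ⟩ (· < · : ι → ι → Prop)).isWellOrder
  -- `g` closes the gaps in the range of `ρ`, so every endpoint of a ray in the ordinal comes from a
  -- point of `X`.
  let g := (enum r).symm
  have hg : ∀ x y, g x < g y ↔ ρ x < ρ y := fun x y => (enum r).symm.map_rel_iff
  refine ⟨type r, ⟨Continuous.homeoOfEquivCompactToT2 (f := g.toEquiv) ?_⟩⟩
  rw [OrderTopology.topology_eq_generate_intervals (α := Set.Iio (type r)),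
    continuous_generateFrom_iff]
  rintro _ ⟨b, rfl | rfl⟩ <;> obtain ⟨x, rfl⟩ := g.surjective b
  · convert hgt x using 1
    ext y
    exact hg x y
  · convert hlt x using 1
    ext y
    exact hg y x

/-! ### The compact space of tagged paths -/

/-- A chain of slaloms of finite weight, strictly increasing modulo finite sets of blocks, such
that each path is caught by a member of the chain in almost all blocks. -/
structure IsCatchingChain {ι : Type} [LinearOrder ι] (A : ι → Slalom) : Prop where
  weight_lt_top : ∀ i, (A i).weight < ∞
  catches : ∀ s : BlockSeq, ∃ i, ∀ᶠ m in atTop, s m ∈ A i m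
  nonempty : ∀ i, ∀ᶠ m in atTop, (A i m).Nonempty
  ssubset : ∀ i j, i < j → ∀ᶠ m in atTop, A i m ⊂ A j m

open Classical in
/-- A path together with the list of tails of the slaloms `A i` that it avoids. -/
noncomputable def tagged {ι : Type} (A : ι → Slalom) (s : BlockSeq) :
    BlockSeq × (ι × ℕ → Bool) :=
  (s, fun p => decide (∀ m, p.2 ≤ m → s m ∉ A p.1 m))

/-- The closure of the set of all tagged paths. -/
abbrev TaggedSpace {ι : Type} (A : ι → Slalom) : Type := closure (Set.range (tagged A))

namespace TaggedSpace

variable {ι : Type} {A : ι → Slalom}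

theorem tagged_snd_iff {s : BlockSeq} {i : ι} {n : ℕ} :
    (tagged A s).2 (i, n) = true ↔ ∀ m, n ≤ m → s m ∉ A i m := by
  simp [tagged]

theorem mem_nhds_iff_forall {x : BlockSeq × (ι × ℕ → Bool)} {V : Set (BlockSeq × (ι × ℕ → Bool))} :
    V ∈ 𝓝 x ↔ ∃ (n : ℕ) (Φ : Finset (ι × ℕ)), ∀ y : BlockSeq × (ι × ℕ → Bool),
      (∀ m < n, y.1 m = x.1 m) → (∀ p ∈ Φ, y.2 p = x.2 p) → y ∈ V := by
  constructor
  · intro hV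
    obtain ⟨U, hU, W, hW, hUW⟩ := mem_nhds_prod_iff.1 hV
    obtain ⟨U', hU', hUo, hxU⟩ := mem_nhds_iff.1 hU
    obtain ⟨W', hW', hWo, hxW⟩ := mem_nhds_iff.1 hW
    obtain ⟨I, u, hu, hIu⟩ := isOpen_pi_iff.1 hUo _ hxU
    obtain ⟨Φ, w, hw, hΦw⟩ := isOpen_pi_iff.1 hWo _ hxW
    refine ⟨I.sup id + 1, Φ, fun y h1 h2 => hUW ⟨hU' (hIu fun m hm => ?_),
      hW' (hΦw fun p hp => ?_)⟩⟩
    · rw [h1 m (Nat.lt_succ_of_le (Finset.le_sup (f := id) hm))]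
      exact (hu m hm).2
    · rw [h2 p hp]
      exact (hw p hp).2
  · rintro ⟨n, Φ, h⟩
    have h1 : ∀ᶠ y in 𝓝 x, ∀ m ∈ Finset.range n, y.1 m = x.1 m :=
      (Finset.eventually_all _).2 fun m _ =>
        ((continuous_apply m).comp continuous_fst).continuousAt.eventually_mem
          ((isOpen_discrete {x.1 m}).mem_nhds rfl)
    have h2 : ∀ᶠ y in 𝓝 x, ∀ p ∈ Φ, y.2 p = x.2 p :=
      (Finset.eventually_all _).2 fun p _ =>
        ((continuous_apply p).comp continuous_snd).continuousAt.eventually_mem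
          ((isOpen_discrete {x.2 p}).mem_nhds rfl)
    filter_upwards [h1, h2] with y hy1 hy2
    exact h y (fun m hm => hy1 m (Finset.mem_range.2 hm)) hy2

theorem exists_approx (x : TaggedSpace A) (n : ℕ) (Φ : Finset (ι × ℕ)) :
    ∃ s : BlockSeq, (∀ m < n, s m = x.1.1 m) ∧ ∀ p ∈ Φ, (tagged A s).2 p = x.1.2 p := by
  obtain ⟨_, ⟨h1, h2⟩, s, rfl⟩ := mem_closure_iff_nhds.1 x.2
    {y | (∀ m < n, y.1 m = x.1.1 m) ∧ ∀ p ∈ Φ, y.2 p = x.1.2 p}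
    (mem_nhds_iff_forall.2 ⟨n, Φ, fun y h1 h2 => ⟨h1, h2⟩⟩)
  exact ⟨s, h1, h2⟩

/-- The point of the closure given by a path. -/
noncomputable def ofPath (A : ι → Slalom) (s : BlockSeq) : TaggedSpace A :=
  ⟨tagged A s, subset_closure ⟨s, rfl⟩⟩

theorem denseRange_ofPath : DenseRange (ofPath A) := by
  intro x
  rw [mem_closure_iff_nhds]
  intro V hV
  obtain ⟨W, hW, hWV⟩ := mem_nhds_subtype _ _ _ |>.1 hV
  obtain ⟨_, h, s, rfl⟩ := mem_closure_iff_nhds.1 x.2 W hW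
  exact ⟨ofPath A s, hWV h, s, rfl⟩

/-- For tagged paths this is the definition, and it passes to the closure because finitely many
coordinates are involved. The converse can fail in the closure, which is what allows several points
over one path. -/
theorem notMem_of_snd {x : TaggedSpace A} {i : ι} {n m : ℕ} (h : x.1.2 (i, n) = true)
    (hm : n ≤ m) : x.1.1 m ∉ A i m := by
  obtain ⟨s, h1, h2⟩ := exists_approx x (m + 1) {(i, n)}
  rw [← h1 m (Nat.lt_succ_self m)]
  rw [← h2 _ (Finset.mem_singleton_self _)] at h
  exact tagged_snd_iff.1 h m hm

theorem snd_of_subset {x : TaggedSpace A} {i j : ι} {n k : ℕ} (h : x.1.2 (j, k) = true)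
    (hkn : k ≤ n) (hij : ∀ m, n ≤ m → A i m ⊆ A j m) : x.1.2 (i, n) = true := by
  classical
  obtain ⟨s, -, h2⟩ := exists_approx x 0 {(i, n), (j, k)}
  rw [← h2 (j, k) (by simp)] at h
  rw [← h2 (i, n) (by simp)]
  exact tagged_snd_iff.2 fun m hm hmem => tagged_snd_iff.1 h m (hkn.trans hm) (hij m hm hmem)

theorem snd_of_notMem {x : TaggedSpace A} {i : ι} {n k : ℕ} (h : x.1.2 (i, k) = true)
    (hx : ∀ m, n ≤ m → m < k → x.1.1 m ∉ A i m) : x.1.2 (i, n) = true := by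
  classical
  obtain ⟨s, h1, h2⟩ := exists_approx x k {(i, n), (i, k)}
  rw [← h2 (i, k) (by simp)] at h
  rw [← h2 (i, n) (by simp)]
  refine tagged_snd_iff.2 fun m hm => ?_
  rcases lt_or_ge m k with hmk | hmk
  · rw [h1 m hmk]
    exact hx m hm hmk
  · exact tagged_snd_iff.1 h m hmk

theorem isOpen_snd (i : ι) (n : ℕ) (b : Bool) : IsOpen {x : TaggedSpace A | x.1.2 (i, n) = b} :=
  (isOpen_discrete {b}).preimage (f := fun x : TaggedSpace A => x.1.2 (i, n)) (by fun_prop)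

instance : CompactSpace (TaggedSpace A) :=
  isCompact_iff_compactSpace.1 isClosed_closure.isCompact

variable [LinearOrder ι]

theorem exists_forall_snd_false (hA : IsCatchingChain A) (x : TaggedSpace A) :
    {i | ∀ n, x.1.2 (i, n) = false}.Nonempty := by
  obtain ⟨i, hi⟩ := hA.catches x.1.1
  refine ⟨i, fun n => ?_⟩
  rw [← Bool.not_eq_true]
  intro h
  obtain ⟨m, hm, hnm⟩ := (hi.and (eventually_ge_atTop n)).exists
  exact notMem_of_snd h hnm hm

/-- Below an index, finitely many slaloms of the chain do not cover the slalom at that index. -/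
theorem eventually_exists_mem_forall_notMem (hA : IsCatchingChain A) (j : ι) (S : Finset ι)
    (hS : ∀ i ∈ S, i < j) :
    ∀ᶠ m in atTop, ∃ z ∈ A j m, ∀ i ∈ S, z ∉ A i m := by
  rcases S.eq_empty_or_nonempty with rfl | hne
  · filter_upwards [hA.nonempty j] with m hm
    obtain ⟨z, hz⟩ := hm
    exact ⟨z, hz, by simp⟩
  · have hmax := S.max'_mem hne
    have hle : ∀ᶠ m in atTop, ∀ i ∈ S, A i m ⊆ A (S.max' hne) m := by
      refine (Finset.eventually_all _).2 fun i hi => ?_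
      rcases (S.le_max' i hi).eq_or_lt with h | h
      · exact Eventually.of_forall fun m => by rw [← h]
      · exact (hA.ssubset _ _ h).mono fun m hm => hm.subset
    filter_upwards [hle, hA.ssubset _ _ (hS _ hmax)] with m h1 h2
    obtain ⟨z, hz, hz'⟩ := Finset.exists_of_ssubset h2
    exact ⟨z, hz, fun i hi h => hz' (h1 i hi h)⟩

/-! ### The rank and the points over one path -/

variable [WellFoundedLT ι]

/-- The first index no tail of which is avoided by the point. -/
noncomputable def rank (hA : IsCatchingChain A) (x : TaggedSpace A) : ι :=
  wellFounded_lt.min {i | ∀ n, x.1.2 (i, n) = false} (exists_forall_snd_false hA x)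

theorem snd_rank (hA : IsCatchingChain A) (x : TaggedSpace A) (n : ℕ) :
    x.1.2 (rank hA x, n) = false :=
  wellFounded_lt.min_mem _ (exists_forall_snd_false hA x) n

/-- A true tag at an index above the rank would, by almost inclusion, give a true tag at the rank
itself, from a later block on. -/
theorem lt_rank_iff (hA : IsCatchingChain A) {x : TaggedSpace A} {i : ι} :
    i < rank hA x ↔ ∃ n, x.1.2 (i, n) = true := by
  constructor
  · intro h
    by_contra! hn
    exact wellFounded_lt.not_lt_min {i | ∀ n, x.1.2 (i, n) = false}
      (by simpa using hn : ∀ n, x.1.2 (i, n) = false) h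
  · rintro ⟨n, hn⟩
    by_contra! h
    rcases h.eq_or_lt with h | h
    · have := snd_rank hA x n
      rw [h, hn] at this
      exact Bool.noConfusion this
    · obtain ⟨k, hk⟩ := eventually_atTop.1 (hA.ssubset _ _ h)
      have := snd_of_subset hn (le_max_left n k)
        fun m hm => (hk m ((le_max_right _ _).trans hm)).subset
      rw [snd_rank] at this
      exact Bool.noConfusion this

/-- Compact sets of points over a single path are homeomorphic to ordinals. -/
theorem isHomeomorphicToOrdinal_of_fst_eq (hA : IsCatchingChain A) {F : Set (TaggedSpace A)}
    (hF : IsCompact F) (s : BlockSeq) (hs : ∀ x ∈ F, x.1.1 = s) : IsHomeomorphicToOrdinal F := by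
  have : CompactSpace F := isCompact_iff_compactSpace.1 hF
  -- Over the path `s` the rank determines all tags: they are the true ones below the rank and false
  -- from the rank on.
  have hsnd : ∀ x ∈ F, ∀ i n, x.1.2 (i, n) = true ↔
      i < rank hA x ∧ ∀ m, n ≤ m → s m ∉ A i m := by
    intro x hx i n
    refine ⟨fun h => ⟨(lt_rank_iff hA).2 ⟨n, h⟩, fun m hm => hs x hx ▸ notMem_of_snd h hm⟩, ?_⟩
    rintro ⟨h, hm⟩
    obtain ⟨k, hk⟩ := (lt_rank_iff hA).1 h
    exact snd_of_notMem hk fun m hnm _ => hs x hx ▸ hm m hnm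
  refine isHomeomorphicToOrdinal_of_rank (fun x : F => rank hA x.1) ?_ ?_ ?_
  · intro x y hxy
    refine Subtype.ext (Subtype.ext (Prod.ext ?_ ?_))
    · rw [hs _ x.2, hs _ y.2]
    · funext ⟨i, n⟩
      rw [Bool.eq_iff_iff, hsnd _ x.2, hsnd _ y.2]
      simp only at hxy
      rw [hxy]
  · intro x
    simp_rw [lt_rank_iff hA, Set.ofPred_exists]
    exact isOpen_iUnion fun n => (isOpen_snd _ n true).preimage continuous_subtype_val
  · intro x
    have : {y : F | rank hA y.1 < rank hA x.1} =
        ⋃ i ∈ Set.Iio (rank hA x.1), {y : F | ¬ i < rank hA y.1} := by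
      ext y
      simp only [Set.mem_ofPred_eq, Set.mem_iUnion, Set.mem_Iio, exists_prop, not_lt]
      exact ⟨fun h => ⟨_, h, le_rfl⟩, fun ⟨i, h1, h2⟩ => h2.trans_lt h1⟩
    rw [this]
    refine isOpen_biUnion fun i hi => ?_
    -- Since `i` is below the rank of `x`, the path `s` avoids `A i` from some `n` on; over `s` the
    -- single tag `(i, n)` then decides whether a rank exceeds `i`.
    obtain ⟨n, hn⟩ := (lt_rank_iff hA).1 hi
    have hn' := ((hsnd _ x.2 i n).1 hn).2
    have : {y : F | ¬ i < rank hA y.1} = {y : F | y.1.1.2 (i, n) = false} := by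
      ext y
      have := hsnd _ y.2 i n
      rw [Set.mem_ofPred_eq, Set.mem_ofPred_eq, ← Bool.not_eq_true, this]
      tauto
    rw [this]
    exact (isOpen_snd _ n false).preimage continuous_subtype_val

/-! ### Nonseparability and countable `π`-bases -/

theorem not_separableSpace (hMA : MartinsAxiom) (hA : IsCatchingChain A) :
    ¬ SeparableSpace (TaggedSpace A) := by
  intro _
  obtain ⟨D, hDc, hDd⟩ := exists_countable_dense (TaggedSpace A)
  obtain ⟨B, hB, hDB⟩ := Slalom.exists_upper_bound hMA (ι := D)
    ((mk_le_aleph0_iff.2 hDc.to_subtype).trans_lt aleph0_lt_continuum)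
    (fun x => A (rank hA x.1)) fun x => hA.weight_lt_top _
  obtain ⟨s, hs⟩ := Slalom.exists_eventually_notMem hB
  obtain ⟨i, hi⟩ := hA.catches s
  -- The path `t` only serves to make the clopen set of the tag `(i, n)` nonempty.
  obtain ⟨t, ht⟩ := Slalom.exists_eventually_notMem (hA.weight_lt_top i)
  obtain ⟨n, hn⟩ := eventually_atTop.1 ht
  obtain ⟨x, hx, hxD⟩ := hDd.inter_open_nonempty _ (isOpen_snd i n true)
    ⟨ofPath A t, tagged_snd_iff.2 hn⟩
  have hlt := (lt_rank_iff hA).2 ⟨n, hx⟩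
  obtain ⟨m, h1, h2, h3, h4⟩ :=
    (hs.and (hi.and ((hA.ssubset _ _ hlt).and (hDB ⟨x, hxD⟩)))).exists
  exact h1 (h4 (h3.subset h2))

/-- Let `a` be the rank of `x`. A set `U ⟨M, z⟩` follows `x` before block `M`, takes the value `z`
there, and avoids `A a` afterwards. Given finitely many tags, choose `z` in `A a M` but outside the
relevant `A i M` with `i < a`: indices below `a` keep their tags since `A i` is almost contained in
`A a`, while `z` falsifies the tags at indices from `a` on. -/
theorem exists_countable_isPiBaseAt (hA : IsCatchingChain A) (x : TaggedSpace A) :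
    ∃ ℬ : Set (Set (TaggedSpace A)), IsPiBaseAt ℬ x ∧ ℬ.Countable := by
  classical
  let a := rank hA x
  let U : (Σ m : ℕ, Fin (2 ^ m)) → Set (TaggedSpace A) := fun q =>
    {y | (∀ m < q.1, y.1.1 m = x.1.1 m) ∧ y.1.1 q.1 = q.2 ∧ y.1.2 (a, q.1 + 1) = true}
  refine ⟨Set.range U ∩ {V | V.Nonempty}, ⟨?_, fun V hV hxV => ?_⟩,
    (Set.countable_range U).mono Set.inter_subset_left⟩
  · rintro _ ⟨⟨q, rfl⟩, hq⟩
    refine ⟨?_, hq⟩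
    have h1 : ∀ m, Continuous fun y : TaggedSpace A => y.1.1 m := fun m =>
      (continuous_apply m).comp (continuous_fst.comp continuous_subtype_val)
    have : U q = (⋂ m ∈ Finset.range q.1, {y : TaggedSpace A | y.1.1 m = x.1.1 m}) ∩
        ({y | y.1.1 q.1 = q.2} ∩ {y | y.1.2 (a, q.1 + 1) = true}) := by
      ext y
      simp [U]
    rw [this]
    exact (isOpen_biInter_finset fun m _ => (isOpen_discrete {x.1.1 m}).preimage (h1 m)).inter
      (((isOpen_discrete {q.2}).preimage (h1 q.1)).inter (isOpen_snd _ _ _))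
  · obtain ⟨W, hW, hWV⟩ := (mem_nhds_subtype _ _ _).1 (hV.mem_nhds hxV)
    obtain ⟨n, Φ, hΦ⟩ := mem_nhds_iff_forall.1 hW
    let S : Finset ι := (Φ.image Prod.fst).filter fun i => i < a
    have e1 := eventually_exists_mem_forall_notMem hA a S
      (fun i hi => (Finset.mem_filter.1 hi).2)
    have e2 : ∀ᶠ M in atTop, ∀ p ∈ Φ, p.1 < a → ∀ m, M ≤ m → A p.1 m ⊆ A a m := by
      refine (Finset.eventually_all _).2 fun p _ => ?_
      by_cases hp : p.1 < a
      · refine (eventually_forall_ge_atTop.2 (hA.ssubset _ _ hp)).mono fun M hM _ m hm => ?_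
        exact (hM m hm).subset
      · exact Eventually.of_forall fun M h => absurd h hp
    have e3 : ∀ᶠ M in atTop, ∀ p ∈ Φ, a ≤ p.1 → A a M ⊆ A p.1 M := by
      refine (Finset.eventually_all _).2 fun p _ => ?_
      rcases lt_trichotomy a p.1 with hp | hp | hp
      · exact (hA.ssubset _ _ hp).mono fun M hM _ => hM.subset
      · exact Eventually.of_forall fun M _ => by rw [← hp]
      · exact Eventually.of_forall fun M h => absurd h (not_le.2 hp)
    have e4 : ∀ᶠ M in atTop, ∀ p ∈ Φ, p.2 ≤ M :=
      (Finset.eventually_all _).2 fun p _ => eventually_ge_atTop _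
    have e5 : ∀ᶠ M in atTop, ∀ p ∈ Φ, ∀ m, p.2 ≤ m → x.1.1 m ∈ A p.1 m →
        ∃ m < M, p.2 ≤ m ∧ x.1.1 m ∈ A p.1 m := by
      refine (Finset.eventually_all _).2 fun p _ => ?_
      by_cases h : ∃ m, p.2 ≤ m ∧ x.1.1 m ∈ A p.1 m
      · obtain ⟨m, hm⟩ := h
        exact (eventually_gt_atTop m).mono fun M hM _ _ _ => ⟨m, hM, hm⟩
      · push Not at h
        exact Eventually.of_forall fun M m h1 h2 => absurd h2 (h m h1)
    obtain ⟨u, hu⟩ := Slalom.exists_eventually_notMem (hA.weight_lt_top a)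
    obtain ⟨M, ⟨z, hza, hz⟩, h2, h3, h4, h5, h6, hnM⟩ := (e1.and (e2.and (e3.and (e4.and
      (e5.and ((eventually_forall_ge_atTop.2 hu).and (eventually_ge_atTop n))))))).exists
    refine ⟨U ⟨M, z⟩, ⟨⟨_, rfl⟩, ?_⟩, fun y hy => hWV (hΦ y.1 ?_ ?_)⟩
    · refine ⟨ofPath A fun m => if m < M then x.1.1 m else if h : M = m then h ▸ z else u m,
        ?_, ?_, ?_⟩
      · intro m (hm : m < M)
        simp [ofPath, tagged, hm]
      · simp [ofPath, tagged]
      · refine tagged_snd_iff.2 fun m hm => ?_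
        have hm : M + 1 ≤ m := hm
        simp only [show ¬ m < M by omega, show ¬ M = m by omega, if_false, dif_neg, not_false_iff]
        exact h6 m (by omega)
    · exact fun m hm => hy.1 m (lt_of_lt_of_le hm hnM)
    · rintro ⟨i, k⟩ hp
      obtain ⟨hy1, hy2, hy3⟩ := hy
      by_cases hx : x.1.2 (i, k) = true
      · rw [hx]
        have hia : i < a := (lt_rank_iff hA).2 ⟨k, hx⟩
        refine snd_of_notMem (snd_of_subset hy3 le_rfl
          fun m hm => h2 _ hp hia m (Nat.le_of_succ_le hm)) fun m hkm hmM => ?_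
        rcases (Nat.lt_succ_iff.1 hmM : m ≤ M).lt_or_eq with hm | rfl
        · rw [hy1 m hm]
          exact notMem_of_snd hx hkm
        · rw [hy2]
          exact hz i (Finset.mem_filter.2 ⟨Finset.mem_image.2 ⟨_, hp, rfl⟩, hia⟩)
      · rw [Bool.not_eq_true] at hx
        rw [hx, ← Bool.not_eq_true]
        intro hy
        by_cases h : ∃ m, k ≤ m ∧ x.1.1 m ∈ A i m
        · obtain ⟨m, hm1, hm2⟩ := h
          obtain ⟨m', hm', hkm', hmem⟩ := h5 _ hp m hm1 hm2
          rw [← hy1 m' hm'] at hmem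
          exact notMem_of_snd hy hkm' hmem
        · push Not at h
          have hia : a ≤ i := by
            by_contra! hia
            obtain ⟨l, hl⟩ := (lt_rank_iff hA).1 hia
            rw [snd_of_notMem hl fun m hm _ => h m hm] at hx
            exact Bool.noConfusion hx
          refine notMem_of_snd hy (h4 _ hp) ?_
          rw [hy2]
          exact h3 _ hp hia hza

theorem piCharacter_le_aleph0 (hA : IsCatchingChain A) :
    piCharacter (TaggedSpace A) ≤ ℵ₀ := by
  refine ciSup_le' fun x => ?_
  obtain ⟨ℬ, hℬ, hc⟩ := exists_countable_isPiBaseAt hA x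
  exact (csInf_le' (s := {κ | ∃ 𝒞 : Set (Set (TaggedSpace A)), IsPiBaseAt 𝒞 x ∧ #𝒞 = κ})
    ⟨ℬ, hℬ, rfl⟩).trans (mk_le_aleph0_iff.2 hc.to_subtype)

end TaggedSpace

/-! ### The measure -/

/-- A compact Hausdorff space supports a measure if a probability space has a map into it for which
compositions with continuous functions are measurable and preimages of nonempty open sets are not
null. -/
theorem supportsRadonMeasure_of_map {X Ω : Type*} [TopologicalSpace X] [CompactSpace X] [T2Space X]
    [MeasurableSpace Ω] (μ : Measure Ω) [IsFiniteMeasure μ] (e : Ω → X)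
    (he : ∀ φ : C(X, ℝ), Measurable (φ ∘ e))
    (hpos : ∀ U : Set X, IsOpen U → U.Nonempty → 0 < μ (e ⁻¹' U)) : SupportsRadonMeasure X := by
  let _ : MeasurableSpace X := borel X
  have : BorelSpace X := ⟨rfl⟩
  have hint : ∀ φ : C(X, ℝ), Integrable (fun s => φ (e s)) μ := fun φ =>
    Integrable.of_bound (he φ).aestronglyMeasurable ‖φ‖
      (Eventually.of_forall fun s => φ.norm_coe_le_norm (e s))
  -- Since `e` is not assumed Borel, no image measure is formed: the functional integrating `φ ∘ e`
  -- is represented by a Radon measure instead.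
  let Λ : CompactlySupportedContinuousMap X ℝ →ₚ[ℝ] ℝ := PositiveLinearMap.mk₀
    { toFun := fun φ => ∫ s, φ (e s) ∂μ
      map_add' := fun φ ψ => integral_add (hint φ.toContinuousMap) (hint ψ.toContinuousMap)
      map_smul' := fun a φ => integral_const_mul a _ }
    fun φ hφ => integral_nonneg fun s => hφ (e s)
  refine ⟨RealRMK.rieszMeasure Λ, inferInstance, inferInstance, fun U hU ⟨x, hx⟩ => ?_⟩
  rw [pos_iff_ne_zero]
  intro hzero
  obtain ⟨φ, hφ0, hφ1, hφ⟩ := exists_continuous_zero_one_of_isClosed hU.isClosed_compl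
    (isClosed_singleton (x := x)) (Set.disjoint_singleton_right.2 fun h => h hx)
  let ψ : CompactlySupportedContinuousMap X ℝ :=
    ⟨φ, HasCompactSupport.of_compactSpace _⟩
  have h1 : ∫ y, φ y ∂(RealRMK.rieszMeasure Λ) = ∫ s, φ (e s) ∂μ :=
    RealRMK.integral_rieszMeasure Λ ψ
  have h2 : ∫ y, φ y ∂(RealRMK.rieszMeasure Λ) = 0 := by
    refine integral_eq_zero_of_ae ?_
    filter_upwards [measure_eq_zero_iff_ae_notMem.1 hzero] with y hy
    exact hφ0 hy
  have h3 : 0 < ∫ s, φ (e s) ∂μ := by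
    rw [integral_pos_iff_support_of_nonneg (fun s => (hφ (e s)).1) (hint φ)]
    refine hpos {y | φ y ≠ 0} (isOpen_ne.preimage φ.continuous) ⟨x, ?_⟩
    simp [hφ1 (Set.mem_singleton x)]
  exact h3.ne' (h1.symm.trans h2)

/-- The product of the uniform measures on the blocks. -/
noncomputable def blockMeasure : Measure BlockSeq :=
  Measure.infinitePi fun n => ProbabilityTheory.uniformOn (Set.univ : Set (Fin (2 ^ n)))

instance : IsProbabilityMeasure blockMeasure := by
  unfold blockMeasure
  infer_instance

theorem uniformOn_block (n : ℕ) (S : Finset (Fin (2 ^ n))) :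
    ProbabilityTheory.uniformOn Set.univ (S : Set (Fin (2 ^ n))) = S.card * 2⁻¹ ^ n := by
  rw [ProbabilityTheory.uniformOn_univ, Measure.count_apply_finset, Fintype.card_fin,
    ENNReal.inv_pow.symm, div_eq_mul_inv]
  simp

theorem blockMeasure_pi (I : Finset ℕ) (S : Slalom) :
    blockMeasure {s | ∀ m ∈ I, s m ∈ S m} = ∏ m ∈ I, ((S m).card : ℝ≥0∞) * 2⁻¹ ^ m := by
  have : {s : BlockSeq | ∀ m ∈ I, s m ∈ S m} = Set.pi I fun m => (S m : Set (Fin (2 ^ m))) := by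
    ext s
    simp
  rw [this, blockMeasure, Measure.infinitePi_pi _ fun m _ => (S m).measurableSet]
  exact Finset.prod_congr rfl fun m _ => uniformOn_block m (S m)

/-- By independence, given the first `n` values, the probability of meeting `A` later is at most the
weight of the tail, which is less than 1. -/
theorem blockMeasure_avoid_pos (t : BlockSeq) {A : Slalom} {n : ℕ} (hA : (A.tail n).weight < 1) :
    0 < blockMeasure {s | (∀ m < n, s m = t m) ∧ ∀ m, n ≤ m → s m ∉ A m} := by
  let S : Slalom := fun m => if m < n then {t m} else A m
  have hS : ∀ m < n, S m = {t m} := fun m hm => if_pos hm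
  have hS' : ∀ m, n ≤ m → S m = A m := fun m hm => if_neg (not_lt.2 hm)
  let C : Set BlockSeq := {s | ∀ m ∈ Finset.range n, s m ∈ S m}
  have hC : blockMeasure C ≠ 0 := by
    rw [blockMeasure_pi, Finset.prod_ne_zero_iff]
    intro m hm
    rw [hS m (Finset.mem_range.1 hm)]
    simp
  have hstep : ∀ k, blockMeasure {s | ∀ m ∈ insert (k + n) (Finset.range n), s m ∈ S m} =
      ((A (k + n)).card : ℝ≥0∞) * 2⁻¹ ^ (k + n) * blockMeasure C := by
    intro k
    rw [blockMeasure_pi, blockMeasure_pi, Finset.prod_insert (by simp), hS' _ (by omega)]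
  rw [pos_iff_ne_zero]
  intro h0
  have hle : blockMeasure C ≤ (A.tail n).weight * blockMeasure C := by
    rw [Slalom.weight_tail, ← ENNReal.tsum_mul_right]
    simp_rw [← hstep]
    rw [← zero_add (∑' k, _), ← h0]
    refine (measure_mono ?_).trans ((measure_union_le _ _).trans
      (add_le_add_right (measure_iUnion_le _) _))
    intro s hs
    have hst : ∀ m < n, s m = t m := fun m hm => by
      have := hs m (Finset.mem_range.2 hm)
      rwa [hS m hm, Finset.mem_singleton] at this
    by_cases h : ∀ m, n ≤ m → s m ∉ A m
    · exact Or.inl ⟨hst, h⟩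
    · push Not at h
      obtain ⟨m, hm, hmem⟩ := h
      obtain ⟨k, rfl⟩ := Nat.exists_eq_add_of_le' hm
      refine Or.inr (Set.mem_iUnion.2 ⟨k, fun l hl => ?_⟩)
      rcases Finset.mem_insert.1 hl with rfl | hl
      · rwa [hS' _ hm]
      · exact hs l hl
  have hlt : (A.tail n).weight * blockMeasure C < 1 * blockMeasure C :=
    ENNReal.mul_lt_mul_left hC (measure_ne_top _ _) hA
  rw [one_mul] at hlt
  exact absurd hle (not_le.2 hlt)

namespace TaggedSpace

variable {ι : Type} {A : ι → Slalom}

/-- Stone–Weierstrass: the functions with measurable composition form a closed subalgebra, and the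
coordinate functions in it separate points. -/
theorem measurable_comp_ofPath (φ : C(TaggedSpace A, ℝ)) : Measurable (φ ∘ ofPath A) := by
  let S : Subalgebra ℝ C(TaggedSpace A, ℝ) :=
    { carrier := {φ | Measurable (φ ∘ ofPath A)}
      mul_mem' := fun h1 h2 => Measurable.mul h1 h2
      add_mem' := fun h1 h2 => Measurable.add h1 h2
      algebraMap_mem' := fun r => measurable_const }
  have hclosed : IsClosed (S : Set C(TaggedSpace A, ℝ)) := by
    refine IsSeqClosed.isClosed fun u ψ hu hψ => ?_
    refine measurable_of_tendsto_metrizable (fun n => hu n) (tendsto_pi_nhds.2 fun s => ?_)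
    exact ((continuous_eval_const (F := C(TaggedSpace A, ℝ)) (ofPath A s)).tendsto ψ).comp hψ
  have hsep : S.SeparatesPoints := by
    intro x y hxy
    by_cases h1 : ∀ m, x.1.1 m = y.1.1 m
    · have h2 : ¬ ∀ p, x.1.2 p = y.1.2 p := fun h2 =>
        hxy (Subtype.ext (Prod.ext (funext h1) (funext h2)))
      push Not at h2
      obtain ⟨⟨i, n⟩, h2⟩ := h2
      let c : Bool → ℝ := fun b => if b then 1 else 0
      have hc : Continuous c := continuous_of_discreteTopology
      refine ⟨_, ⟨⟨fun z : TaggedSpace A => c (z.1.2 (i, n)), by fun_prop⟩, ?_, rfl⟩, ?_⟩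
      · have hT : MeasurableSet {s : BlockSeq | ∀ m, n ≤ m → s m ∉ A i m} := by
          simp_rw [Set.ofPred_forall]
          refine MeasurableSet.iInter fun m => MeasurableSet.iInter fun _ => ?_
          exact ((A i m).measurableSet.preimage (measurable_pi_apply m)).compl
        classical
        have : (fun s : BlockSeq => c ((tagged A s).2 (i, n))) =
            fun s => if s ∈ {s : BlockSeq | ∀ m, n ≤ m → s m ∉ A i m} then (1 : ℝ) else 0 := by
          funext s
          simp only [c, tagged_snd_iff, Set.mem_ofPred_eq]
        change Measurable fun s : BlockSeq => c ((tagged A s).2 (i, n))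
        rw [this]
        exact Measurable.ite hT measurable_const measurable_const
      · revert h2
        simp only [ContinuousMap.coe_mk, c]
        cases x.1.2 (i, n) <;> cases y.1.2 (i, n) <;> simp
    · push Not at h1
      obtain ⟨m, hm⟩ := h1
      let c : Fin (2 ^ m) → ℝ := fun k => (k : ℕ)
      have hc : Continuous c := continuous_of_discreteTopology
      refine ⟨_, ⟨⟨fun z : TaggedSpace A => c (z.1.1 m), by fun_prop⟩, ?_, rfl⟩, ?_⟩
      · exact (measurable_of_finite c).comp (measurable_pi_apply m)
      · simpa [c, Fin.ext_iff] using hm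
  have htop := ContinuousMap.subalgebra_topologicalClosure_eq_top_of_separatesPoints S hsep
  have : φ ∈ S.topologicalClosure := htop ▸ Algebra.mem_top
  exact hclosed.closure_subset this

/-- Near a tagged path `t`, it suffices to follow `t` up to a late block `M` and then avoid the
union `B` of the finitely many slaloms involved: every false tag at `t` among the finitely many
considered has been witnessed before `M`. -/
theorem blockMeasure_preimage_pos (hA : ∀ i, (A i).weight < ∞) {U : Set (TaggedSpace A)}
    (hU : IsOpen U) (hne : U.Nonempty) : 0 < blockMeasure (ofPath A ⁻¹' U) := by
  classical
  obtain ⟨t, ht⟩ := denseRange_ofPath.exists_mem_open hU hne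
  obtain ⟨W, hW, hWU⟩ := (mem_nhds_subtype _ _ _).1 (hU.mem_nhds ht)
  obtain ⟨n, Φ, hΦ⟩ := mem_nhds_iff_forall.1 hW
  let B : Slalom := Φ.sup fun p => A p.1
  have hB : B.weight < ∞ := by
    refine Finset.sup_induction (p := fun B : Slalom => B.weight < ∞) ?_
      (fun B hB C hC => (Slalom.weight_sup_le B C).trans_lt (ENNReal.add_lt_top.2 ⟨hB, hC⟩))
      fun p _ => hA p.1
    simp [Slalom.weight]
  have hAB : ∀ p ∈ Φ, ∀ m, A p.1 m ⊆ B m := fun p hp m =>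
    Finset.le_sup (f := fun p : ι × ℕ => A p.1) hp m
  have e1 : ∀ᶠ M in atTop, ∀ p ∈ Φ, p.2 ≤ M :=
    (Finset.eventually_all _).2 fun p _ => eventually_ge_atTop _
  have e2 : ∀ᶠ M in atTop, ∀ p ∈ Φ, ∀ m, p.2 ≤ m → t m ∈ A p.1 m →
      ∃ m < M, p.2 ≤ m ∧ t m ∈ A p.1 m := by
    refine (Finset.eventually_all _).2 fun p _ => ?_
    by_cases h : ∃ m, p.2 ≤ m ∧ t m ∈ A p.1 m
    · obtain ⟨m, hm⟩ := h
      exact (eventually_gt_atTop m).mono fun M hM _ _ _ => ⟨m, hM, hm⟩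
    · push Not at h
      exact Eventually.of_forall fun M m h1 h2 => absurd h2 (h m h1)
  obtain ⟨M, h1, h2, h3, h4⟩ := (e1.and (e2.and ((eventually_ge_atTop n).and
    ((Slalom.tendsto_weight_tail hB).eventually_lt_const zero_lt_one)))).exists
  refine (blockMeasure_avoid_pos t h4).trans_le (measure_mono ?_)
  rintro s ⟨hs1, hs2⟩
  refine hWU (hΦ _ (fun m hm => hs1 m (hm.trans_le h3)) ?_)
  rintro ⟨i, k⟩ hp
  change (tagged A s).2 (i, k) = (tagged A t).2 (i, k)
  rw [Bool.eq_iff_iff, tagged_snd_iff, tagged_snd_iff]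
  constructor
  · intro h m hm hmem
    obtain ⟨m', hm', hk, hmem'⟩ := h2 _ hp m hm hmem
    rw [← hs1 m' hm'] at hmem'
    exact h m' hk hmem'
  · intro h m hm
    rcases lt_or_ge m M with hmM | hmM
    · rw [hs1 m hmM]
      exact h m hm
    · exact fun hmem => hs2 m hmM (hAB _ hp m hmem)

theorem supportsRadonMeasure (hA : ∀ i, (A i).weight < ∞) :
    SupportsRadonMeasure (TaggedSpace A) :=
  supportsRadonMeasure_of_map blockMeasure (ofPath A) measurable_comp_ofPath
    fun _ hU hne => blockMeasure_preimage_pos hA hU hne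

end TaggedSpace

/-! ### No surjection onto an uncountable cube -/

/-- A continuous function from a compact well-order to a metrizable space has countable range. -/
theorem countable_range_of_wellFoundedLT {W M : Type*} [LinearOrder W] [WellFoundedLT W]
    [TopologicalSpace W] [OrderTopology W] [CompactSpace W] [TopologicalSpace M]
    [FirstCountableTopology M] [T1Space M] {h : W → M} (hh : Continuous h) :
    (Set.range h).Countable := by
  have key : ∀ a, (h '' Set.Iic a).Countable := by
    intro a
    induction a using WellFoundedLT.induction with
    | ind a ih =>
    by_cases hmin : ∃ l, l < a
    · obtain ⟨u, hu⟩ := (𝓝 (h a)).exists_antitone_basis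
      -- A point of `Set.Iic a` above every `l k` has its value in all `u k`, hence equal to `h a`;
      -- the other points lie in countably many smaller initial segments.
      have : ∀ k, ∃ l < a, Set.Ioc l a ⊆ h ⁻¹' u k := fun k =>
        exists_Ioc_subset_of_mem_nhds (hh.continuousAt (hu.1.mem_of_mem trivial)) hmin
      choose l hl hlu using this
      refine ((Set.countable_singleton (h a)).union
        (Set.countable_iUnion fun k => ih (l k) (hl k))).mono ?_
      rintro _ ⟨x, hx, rfl⟩
      by_cases hk : ∃ k, x ≤ l k
      · obtain ⟨k, hk⟩ := hk
        exact Or.inr (Set.mem_iUnion.2 ⟨k, x, hk, rfl⟩)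
      · push Not at hk
        refine Or.inl ?_
        by_contra hne
        obtain ⟨k, -, hk'⟩ := hu.1.mem_iff.1 (isOpen_ne.mem_nhds (Ne.symm hne : h a ≠ h x))
        exact hk' (hlu k ⟨hk k, hx⟩) rfl
    · push Not at hmin
      refine (Set.countable_singleton (h a)).mono ?_
      rintro _ ⟨x, hx, rfl⟩
      rw [le_antisymm hx (hmin x)]
      rfl
  rcases isEmpty_or_nonempty W with hW | hW
  · simp [Set.range_eq_empty]
  · obtain ⟨a, ha⟩ := isCompact_univ.exists_isGreatest (Set.univ_nonempty (α := W))
    refine (key a).mono ?_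
    rintro _ ⟨x, rfl⟩
    exact ⟨x, ha.2 trivial, rfl⟩

theorem IsHomeomorphicToOrdinal.countable_range {X : Type} {M : Type*} [TopologicalSpace X]
    [CompactSpace X] [TopologicalSpace M] [FirstCountableTopology M] [T1Space M]
    (hX : IsHomeomorphicToOrdinal X) {h : X → M} (hh : Continuous h) :
    (Set.range h).Countable := by
  obtain ⟨o, ⟨e⟩⟩ := hX
  have : CompactSpace (Set.Iio o) := e.compactSpace
  have := countable_range_of_wellFoundedLT (hh.comp e.symm.continuous)
  rwa [e.symm.surjective.range_comp] at this

/-- If a compact space maps onto a superset of `2 ^ κ` and into `2 ^ ω`, then some fibre of the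
latter map still maps onto a copy of `2 ^ κ` with countably many coordinates fixed. -/
theorem exists_fiber_of_boolCube {X κ Y : Type*} [TopologicalSpace X] [CompactSpace X]
    [TopologicalSpace Y] [T2Space Y] {f : X → ℕ → Bool} (hf : Continuous f)
    {g : X → Y} (hg : Continuous g) {c : (κ → Bool) → Y} (hc : Continuous c)
    (hcg : Set.range c ⊆ Set.range g) :
    ∃ (t : ℕ → Bool) (C : Set κ) (p : κ → Bool), C.Countable ∧
      ∀ v : κ → Bool, (∀ i ∈ C, v i = p i) → ∃ x, f x = t ∧ g x = c v := by
  classical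
  let Q : ℕ → Finset κ × (κ → Bool) × (ℕ → Bool) → Prop := fun n q =>
    ∀ v : κ → Bool, (∀ i ∈ q.1, v i = q.2.1 i) → ∃ x, (∀ m < n, f x m = q.2.2 m) ∧ g x = c v
  have step : ∀ n (q : {q // Q n q}), ∃ q' : {q // Q (n + 1) q}, q.1.1 ⊆ q'.1.1 ∧
      (∀ i ∈ q.1.1, q'.1.2.1 i = q.1.2.1 i) ∧ ∀ m < n, q'.1.2.2 m = q.1.2.2 m := by
    rintro n ⟨⟨F, p, t⟩, hq⟩
    let Z : Bool → Set X := fun b => {x | (∀ m < n, f x m = t m) ∧ f x n = b}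
    have hfm : ∀ m, Continuous fun x => f x m := fun m => (continuous_apply m).comp hf
    have hZ : ∀ b, IsClosed (Z b) := fun b => by
      have : Z b = (⋂ m ∈ Set.Iio n, {x | f x m = t m}) ∩ {x | f x n = b} := by
        ext x
        simp [Z]
      rw [this]
      exact (isClosed_biInter fun m _ => isClosed_eq (hfm m) continuous_const).inter
        (isClosed_eq (hfm n) continuous_const)
    have upd : ∀ b x, x ∈ Z b → ∀ m < n + 1, f x m = Function.update t n b m := by
      intro b x hx m hm
      rcases (Nat.lt_succ_iff.1 hm).lt_or_eq with h | rfl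
      · rw [Function.update_of_ne h.ne, hx.1 m h]
      · rw [Function.update_self, hx.2]
    -- If bit `false` fails for some `v`, compactness makes it fail on a neighbourhood of `v`;
    -- fixing the finitely many coordinates of that neighbourhood forces bit `true`.
    by_cases hfalse : ∀ v : κ → Bool, (∀ i ∈ F, v i = p i) → ∃ x ∈ Z false, g x = c v
    · refine ⟨⟨⟨F, p, Function.update t n false⟩, fun v hv => ?_⟩, subset_rfl, fun _ _ => rfl,
        fun m hm => Function.update_of_ne hm.ne _ _⟩
      obtain ⟨x, hx, hgx⟩ := hfalse v hv
      exact ⟨x, upd _ x hx, hgx⟩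
    · push Not at hfalse
      obtain ⟨v, hv, hvx⟩ := hfalse
      have hcl : IsClosed (c ⁻¹' (g '' Z false)) :=
        ((hZ false).isCompact.image hg).isClosed.preimage hc
      obtain ⟨F', u, hu, hF'⟩ := isOpen_pi_iff.1 hcl.isOpen_compl v
        (by rintro ⟨x, hx, hgx⟩; exact hvx x hx hgx)
      refine ⟨⟨⟨F ∪ F', v, Function.update t n true⟩, fun w hw => ?_⟩, Finset.subset_union_left,
        hv, fun m hm => Function.update_of_ne hm.ne _ _⟩
      obtain ⟨x, hx, hgx⟩ := hq w fun i hi =>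
        (hw i (Finset.mem_union_left _ hi)).trans (hv i hi)
      refine ⟨x, upd true x ⟨hx, ?_⟩, hgx⟩
      by_contra hb
      rw [Bool.not_eq_true] at hb
      refine hF' (fun i hi => ?_ : w ∈ _) ⟨x, ⟨hx, hb⟩, hgx⟩
      rw [hw i (Finset.mem_union_right _ hi)]
      exact (hu i hi).2
  choose nxt hF hp ht using step
  let q : ∀ n, {q // Q n q} := fun n => Nat.rec
    ⟨(∅, fun _ => false, fun _ => false), fun v _ => by
      obtain ⟨x, hx⟩ := hcg ⟨v, rfl⟩
      exact ⟨x, by simp, hx⟩⟩ nxt n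
  have hq : ∀ n, q (n + 1) = nxt n (q n) := fun n => rfl
  have hFmono : ∀ n k, n ≤ k → (q n).1.1 ⊆ (q k).1.1 := fun n k hnk => by
    induction k, hnk using Nat.le_induction with
    | base => rfl
    | succ k _ ih => exact ih.trans (by rw [hq]; exact hF k _)
  have hpmono : ∀ n k, n ≤ k → ∀ i ∈ (q n).1.1, (q k).1.2.1 i = (q n).1.2.1 i := by
    intro n k hnk i hi
    induction k, hnk using Nat.le_induction with
    | base => rfl
    | succ k hk ih => rw [← ih, hq]; exact hp k _ i (hFmono n k hk hi)
  have htmono : ∀ n k, n ≤ k → ∀ m < n, (q k).1.2.2 m = (q n).1.2.2 m := by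
    intro n k hnk m hm
    induction k, hnk using Nat.le_induction with
    | base => rfl
    | succ k hk ih => rw [← ih, hq]; exact ht k _ m (hm.trans_le hk)
  let C : Set κ := ⋃ n, ((q n).1.1 : Set κ)
  let p : κ → Bool := fun i =>
    if h : ∃ n, i ∈ (q n).1.1 then (q h.choose).1.2.1 i else false
  have hpq : ∀ n, ∀ i ∈ (q n).1.1, p i = (q n).1.2.1 i := by
    intro n i hi
    have h : ∃ n, i ∈ (q n).1.1 := ⟨n, hi⟩
    simp only [p, dif_pos h]
    rcases le_total n h.choose with h' | h'
    · exact hpmono _ _ h' i hi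
    · exact (hpmono _ _ h' i h.choose_spec).symm
  let t : ℕ → Bool := fun m => (q (m + 1)).1.2.2 m
  refine ⟨t, C, p, Set.countable_iUnion fun n => (q n).1.1.countable_toSet, fun v hv => ?_⟩
  -- A point in all these decreasing compact sets realizes the whole of `t` for the given `v`.
  let Y' : ℕ → Set X := fun n => {x | (∀ m < n, f x m = t m) ∧ g x = c v}
  have hY'c : ∀ n, IsClosed (Y' n) := fun n => by
    have : Y' n = (⋂ m ∈ Set.Iio n, {x | f x m = t m}) ∩ {x | g x = c v} := by
      ext x
      simp [Y']
    rw [this]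
    exact (isClosed_biInter fun m _ => isClosed_eq ((continuous_apply m).comp hf)
      continuous_const).inter (isClosed_eq hg continuous_const)
  obtain ⟨x, hx⟩ := IsCompact.nonempty_iInter_of_sequence_nonempty_isCompact_isClosed Y'
    (fun n x hx => ⟨fun m hm => hx.1 m (hm.trans (Nat.lt_succ_self n)), hx.2⟩)
    (fun n => by
      obtain ⟨x, hx, hgx⟩ := (q n).2 v fun i hi =>
        (hv i (Set.mem_iUnion.2 ⟨n, hi⟩)).trans (hpq n i hi)
      exact ⟨x, fun m hm => (hx m hm).trans (htmono (m + 1) n hm m (Nat.lt_succ_self m)), hgx⟩)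
    (hY'c 0).isCompact hY'c
  rw [Set.mem_iInter] at hx
  exact ⟨x, funext fun m => (hx (m + 1)).1 m (Nat.lt_succ_self m), (hx 0).2⟩

/-- A compact space with a map into `2 ^ ω` all whose fibres are ordinals has no continuous
surjection onto an uncountable power of the unit interval. -/
theorem not_surjective_of_fiber_isHomeomorphicToOrdinal {X : Type} {κ : Type*}
    [TopologicalSpace X] [CompactSpace X] [Uncountable κ] {f : X → ℕ → Bool} (hf : Continuous f)
    (hord : ∀ t, IsHomeomorphicToOrdinal (f ⁻¹' {t})) {g : X → κ → unitInterval}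
    (hg : Continuous g) : ¬ Function.Surjective g := by
  classical
  intro hsurj
  let b : Bool → unitInterval := fun b => if b then 1 else 0
  have hb : Function.Injective b := by
    intro x y
    cases x <;> cases y <;> simp [b]
  let c : (κ → Bool) → κ → unitInterval := fun v i => b (v i)
  have hc : Continuous c := continuous_pi fun i =>
    (continuous_of_discreteTopology (f := b)).comp (continuous_apply i)
  obtain ⟨t, C, p, hC, h⟩ := exists_fiber_of_boolCube hf hg hc
    (by rw [hsurj.range_eq]; exact Set.subset_univ _)
  have hinf : Infinite (Cᶜ : Set κ) := by
    refine Set.infinite_coe_iff.2 fun hfin => ?_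
    have := hC.union hfin.countable
    rw [Set.union_compl_self, Set.countable_univ_iff] at this
    exact not_countable this
  -- Countably many coordinates outside `C` remain free, so the fibre over `t` attains every 0-1
  -- sequence on them.
  let j : ℕ → κ := fun k => (Infinite.natEmbedding (Cᶜ : Set κ) k).1
  have hj : Function.Injective j := Subtype.val_injective.comp (Infinite.natEmbedding _).injective
  have : CompactSpace (f ⁻¹' {t}) :=
    isCompact_iff_compactSpace.1 (isClosed_singleton.preimage hf).isCompact
  let φ : f ⁻¹' {t} → ℕ → unitInterval := fun x k => g x.1 (j k)
  have hφ : Continuous φ := continuous_pi fun k =>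
    (continuous_apply _).comp (hg.comp continuous_subtype_val)
  have hcount := (hord t).countable_range hφ
  have hsub : Set.range (fun (w : ℕ → Bool) k => b (w k)) ⊆ Set.range φ := by
    rintro _ ⟨w, rfl⟩
    let v : κ → Bool := fun i => if i ∈ C then p i else w (Function.invFun j i)
    obtain ⟨x, hx, hgx⟩ := h v fun i hi => by simp [v, hi]
    refine ⟨⟨x, hx⟩, funext fun k => ?_⟩
    have hk : j k ∉ C := (Infinite.natEmbedding (Cᶜ : Set κ) k).2
    simp [φ, hgx, c, v, hk, Function.leftInverse_invFun hj k]
  have h2 : (Set.range fun (w : ℕ → Bool) k => b (w k)).Countable := hcount.mono hsub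
  have h3 : Function.Injective fun (w : ℕ → Bool) k => b (w k) := fun w w' h =>
    funext fun k => hb (congrFun h k)
  have h4 : (Set.univ : Set (ℕ → Bool)).Countable := by
    rw [← Set.image_univ] at h2
    exact Set.countable_of_injective_of_countable_image h3.injOn h2
  rw [Set.countable_univ_iff, ← Cardinal.mk_le_aleph0_iff] at h4
  exact not_lt.2 h4 (by simpa using aleph0_lt_continuum)

/-! ### Coding paths in `2^ω` and conclusion -/

theorem uncountable_Iio_omega_one : Uncountable (Set.Iio (ω_ 1 : Ordinal.{0})) := by
  rw [← not_countable_iff, ← Cardinal.mk_le_aleph0_iff, Cardinal.mk_Iio_ordinal]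
  simp

/-- The path of a point of the closure, coded as an element of `2 ^ ω`. -/
def TaggedSpace.code {ι : Type} {A : ι → Slalom} (x : TaggedSpace A) (k : ℕ) : Bool :=
  decide ((x.1.1 k.unpair.1 : ℕ) = k.unpair.2)

theorem TaggedSpace.continuous_code {ι : Type} {A : ι → Slalom} :
    Continuous (TaggedSpace.code (A := A)) := by
  refine continuous_pi fun k => ?_
  exact (continuous_of_discreteTopology
    (f := fun z : Fin (2 ^ k.unpair.1) => decide ((z : ℕ) = k.unpair.2))).comp
    (g := fun z : Fin (2 ^ k.unpair.1) => decide ((z : ℕ) = k.unpair.2))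
    (f := fun x : TaggedSpace A => x.1.1 k.unpair.1) (by fun_prop)

theorem TaggedSpace.fst_eq_of_code_eq {ι : Type} {A : ι → Slalom} {x y : TaggedSpace A}
    (h : x.code = y.code) : x.1.1 = y.1.1 := by
  funext m
  have hk : ∀ (z : BlockSeq) (l : ℕ), (z (Nat.pair m l).unpair.1 : ℕ) = z m := fun z l =>
    congrArg (fun k => (z k : ℕ)) (by rw [Nat.unpair_pair])
  have := congrFun h (Nat.pair m (x.1.1 m))
  unfold code at this
  simp only [hk] at this
  simpa [Fin.ext_iff, eq_comm] using this

theorem TaggedSpace.isHomeomorphicToOrdinal_fiber_code {ι : Type} [LinearOrder ι]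
    [WellFoundedLT ι] {A : ι → Slalom} (hA : IsCatchingChain A) (t : ℕ → Bool) :
    IsHomeomorphicToOrdinal (TaggedSpace.code (A := A) ⁻¹' {t}) := by
  have hF := (isClosed_singleton.preimage (continuous_code (A := A)) (t := {t})).isCompact
  rcases (TaggedSpace.code (A := A) ⁻¹' {t}).eq_empty_or_nonempty with h | ⟨x, hx⟩
  -- Not every binary sequence codes a path; an empty fibre is the ordinal 0, and the path chosen is
  -- irrelevant.
  · exact isHomeomorphicToOrdinal_of_fst_eq hA hF (fun _ => 0) (by simp [h])
  · exact isHomeomorphicToOrdinal_of_fst_eq hA hF x.1.1 fun y hy =>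
      fst_eq_of_code_eq (Eq.trans hy (Eq.symm hx))

theorem theorem3p3 (hMA : MartinsAxiom) :
    ∃ (K : Type) (_ : TopologicalSpace K), CompactSpace K ∧ T2Space K ∧
      ¬ SeparableSpace K ∧
      SupportsRadonMeasure K ∧
      (∃ f : K → (ℕ → Bool), Continuous f ∧
        ∀ t : ℕ → Bool, IsHomeomorphicToOrdinal (f ⁻¹' {t})) ∧
      (¬ ∃ g : K → (Set.Iio (ω_ 1 : Ordinal.{0}) → unitInterval),
        Continuous g ∧ Function.Surjective g) ∧
      piCharacter K ≤ ℵ₀ := by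
  obtain ⟨ι, _, _, A, hw, hc, hne, hlt⟩ := Slalom.exists_chain hMA
  have hA : IsCatchingChain A := ⟨hw, hc, hne, hlt⟩
  have := uncountable_Iio_omega_one
  exact ⟨TaggedSpace A, inferInstance, inferInstance, inferInstance,
    TaggedSpace.not_separableSpace hMA hA, TaggedSpace.supportsRadonMeasure hw,
    ⟨TaggedSpace.code, TaggedSpace.continuous_code,
      TaggedSpace.isHomeomorphicToOrdinal_fiber_code hA⟩,
    fun ⟨_, hg, hsurj⟩ => not_surjective_of_fiber_isHomeomorphicToOrdinal
      TaggedSpace.continuous_code (TaggedSpace.isHomeomorphicToOrdinal_fiber_code hA) hg hsurj,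
    TaggedSpace.piCharacter_le_aleph0 hA⟩
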